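/- **Definitions.** An *infinitesimally curved surface* is a convex polygon $P$ in the Euclidean plane, of diameter $1$, together with finitely many points $p_1,\dots,p_N$ of its interior in general position (distinct, no three collinear) and weights $\alpha_i\ge 0$ with $\sum_i\alpha_i=1$. A *partition* $L$ of it is a partition of $P$ into convex polygons whose vertices are exactly the vertices of $P$ and the points $p_i$, all angles of the parts at these vertices being less than $\pi$; $E(L)$ is its edge skeleton. A *cut* is a subgraph $G$ of $E(L)$ without edges on $\partial P$ such that $G$ contains every $p_i$ with $\alpha_i>0$, $G\cup\partial P$ is connected, and $G$ has no cycles. An edge $e$ of $G$ is an *A-edge* if deleting $e$ from $G\cup\partial P$ disconnects one endpoint of $e$ (its upper endpoint) from $\partial P$; it is then directed from its upper to its lower endpoint. All other edges of $G$ are *B-edges*. For a point $x$ of $G$ write $p_i>x$ if every path in $G\cup\partial P$ from $p_i$ to $\partial P$ passes through $x$ (allowing $p_i=x$), and put $\alpha_x=\sum_{p_i>x}\alpha_i$ and, if $\alpha_x>0$, $c_x=\alpha_x^{-1}\sum_{p_i>x}\alpha_i p_i$. A cut $G$ is *admissible* if $\langle x-c_x,e\rangle/|e|\ge 0$ for every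 A-edge $e$ and every point $x$ of $e$, other than its lower endpoint, with $\alpha_x>0$. **Theorem 2.** There exist an infinitesimally curved surface $T$ and a partition $L_T$ of it such that: 1. the polygon of $T$ is a triangle, and exactly two of the marked points, $c_1$ and $c_2$, have non-zero weight, each of weight $1/2$; 2. $L_T$ is non-admissible, i.e. every admissible cut of $L_T$ has at least one B-edge; 3. every admissible cut $G$ of $L_T$ connects all points of non-zero weight, i.e. $c_1$ and $c_2$ lie in the same connected component of $G$ (the edges of $\partial T$ are not used). -/

import Mathlib

/-- The Euclidean plane. -/
abbrev Plane : Type := EuclideanSpace ℝ (Fin 2)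

/-- An infinitesimally curved polyhedron (or surface): a convex polygon of diameter `1` with
vertices `corner j`, and finitely many points `inner i` of its interior, in general position
(pairwise distinct, no three on a line), with weights that are non-negative and sum to `1`. -/
structure InfSurface where
  /-- the number of vertices of the polygon -/
  numCorners : ℕ
  /-- the number of marked interior points -/
  numInner : ℕ
  /-- the vertices of the polygon -/
  corner : Fin numCorners → Plane
  /-- the marked interior points -/
  inner : Fin numInner → Plane
  /-- the weights of the marked interior points -/
  weight : Fin numInner → ℝ
  three_le : 3 ≤ numCorners
  corner_convexIndependent : ConvexIndependent ℝ corner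
  diam_eq_one : Metric.diam (convexHull ℝ (Set.range corner)) = 1
  inner_mem : ∀ i, inner i ∈ interior (convexHull ℝ (Set.range corner))
  inner_injective : Function.Injective inner
  inner_general : ∀ i j k, i ≠ j → j ≠ k → i ≠ k →
    ¬ Collinear ℝ {inner i, inner j, inner k}
  weight_nonneg : ∀ i, 0 ≤ weight i
  weight_sum : ∑ i, weight i = 1

namespace InfSurface

variable (S : InfSurface)

/-- The convex polygon `P`. -/
def polygon : Set Plane := convexHull ℝ (Set.range S.corner)

/-- Labels of the vertices: the vertices of the polygon and the marked interior points. -/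
abbrev Vert : Type := Fin S.numCorners ⊕ Fin S.numInner

/-- The position of a vertex in the plane. -/
def pos : S.Vert → Plane := Sum.elim S.corner S.inner

/-- The convex polygon spanned by a set of vertices. -/
def hull (F : Finset S.Vert) : Set Plane := convexHull ℝ (S.pos '' (F : Set S.Vert))

end InfSurface

/-- A partition of the polygon of `S` into convex polygons, whose vertices are exactly the
vertices of the polygon and the marked interior points. A part is given by the set of its
vertices. All angles of the parts at vertices of the partition are less than `π`: the vertices
of a part are in convex position, and no further vertex of the partition lies on the part. -/
structure ConvexPartition (S : InfSurface) where
  /-- the parts, each given by the set of its vertices -/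
  parts : Finset (Finset S.Vert)
  three_le_card : ∀ F ∈ parts, 3 ≤ F.card
  convexIndependent : ∀ F ∈ parts, ConvexIndependent ℝ (fun v : F => S.pos v)
  cover : ⋃ F ∈ parts, S.hull F = S.polygon
  disjoint_interior : ∀ F ∈ parts, ∀ F' ∈ parts, F ≠ F' →
    Disjoint (interior (S.hull F)) (interior (S.hull F'))
  mem_of_mem_hull : ∀ F ∈ parts, ∀ v : S.Vert, S.pos v ∈ S.hull F → v ∈ F
  vertex_mem : ∀ v : S.Vert, ∃ F ∈ parts, v ∈ F

namespace ConvexPartition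

variable {S : InfSurface} (L : ConvexPartition S)

/-- The edge skeleton `E(L)`: two vertices are adjacent when the segment between them is a side
of some part of `L`. -/
def skeleton : SimpleGraph S.Vert where
  Adj u v := u ≠ v ∧ ∃ F ∈ L.parts, u ∈ F ∧ v ∈ F ∧
    segment ℝ (S.pos u) (S.pos v) ⊆ frontier (S.hull F)
  symm := ⟨fun u v h => by
    obtain ⟨hne, F, hF, hu, hv, hs⟩ := h
    exact ⟨hne.symm, F, hF, hv, hu, by rwa [segment_symm]⟩⟩
  loopless := ⟨fun u h => h.1 rfl⟩

/-- The boundary `∂P` as a subgraph of the skeleton: all vertices of the polygon, and the edges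
that lie on its boundary. -/
def boundary : L.skeleton.Subgraph where
  verts := Set.range Sum.inl
  Adj u v := L.skeleton.Adj u v ∧ u ∈ Set.range Sum.inl ∧
    segment ℝ (S.pos u) (S.pos v) ⊆ frontier S.polygon ∧ v ∈ Set.range Sum.inl
  adj_sub h := h.1
  edge_vert h := h.2.1
  symm := ⟨fun u v h => ⟨h.1.symm, h.2.2.2, by rw [segment_symm]; exact h.2.2.1, h.2.1⟩⟩

variable {L}

/-- The graph `G ∪ ∂P`. -/
def withBoundary (G : L.skeleton.Subgraph) : L.skeleton.Subgraph := G ⊔ L.boundary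

/-- A subgraph `G` of `E(L)` without edges on `∂P` is a cut if it contains all points of
positive weight, `G ∪ ∂P` is connected, and `G` has no cycles. -/
structure IsCut (G : L.skeleton.Subgraph) : Prop where
  no_boundary_edge : ∀ u v, G.Adj u v → ¬ L.boundary.Adj u v
  weighted_mem : ∀ i, 0 < S.weight i → Sum.inr i ∈ G.verts
  connected : (withBoundary G).Connected
  acyclic : G.spanningCoe.IsAcyclic

/-- `uv` is an edge of `G` whose removal from `G ∪ ∂P` disconnects `u` from `∂P`. Such an edge
is directed downstream from its upper vertex `u` to its lower vertex `v`. -/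
def IsDownstream (G : L.skeleton.Subgraph) (u v : S.Vert) : Prop :=
  G.Adj u v ∧ ∀ j : Fin S.numCorners,
    ¬ ((withBoundary G).spanningCoe.deleteEdges {s(u, v)}).Reachable u (Sum.inl j)

/-- `uv` is an `A`-edge of `G`: it disconnects one of its vertices from `∂P`. -/
def IsAEdge (G : L.skeleton.Subgraph) (u v : S.Vert) : Prop :=
  IsDownstream G u v ∨ IsDownstream G v u

/-- `uv` is a `B`-edge of `G`: an edge that is not an `A`-edge. -/
def IsBEdge (G : L.skeleton.Subgraph) (u v : S.Vert) : Prop :=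
  G.Adj u v ∧ ¬ IsAEdge G u v

/-- `w` is upstream to `x` (`w` equal to `x` is allowed): every walk in `G ∪ ∂P` from the
vertex `w` to `∂P` passes through `x`. -/
def Upstream (G : L.skeleton.Subgraph) (w x : S.Vert) : Prop :=
  w ∈ (withBoundary G).verts ∧
    ∀ (j : Fin S.numCorners) (p : (withBoundary G).spanningCoe.Walk w (Sum.inl j)),
      x ∈ p.support

open Classical in
/-- The total weight `α_x` of the marked points upstream to the vertex `x`. -/
noncomputable def streamWeight (G : L.skeleton.Subgraph) (x : S.Vert) : ℝ :=
  ∑ i with Upstream G (Sum.inr i) x, S.weight i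

open Classical in
/-- The rotation center `c_x`: the weighted barycenter of the marked points upstream to the
vertex `x`. -/
noncomputable def rotationCenter (G : L.skeleton.Subgraph) (x : S.Vert) : Plane :=
  (streamWeight G x)⁻¹ • ∑ i with Upstream G (Sum.inr i) x, S.weight i • S.inner i

/-- A cut `G` is admissible if `⟨x - c_x, e⟩ / |e| ≥ 0` for every point `x` with `α_x > 0` on an
`A`-edge `e` directed downstream. Here `x` runs over the edge `e = uv` without its lower end `v`
(at which the downstream edge is the next one); the marked points upstream to such a point `x`
are those upstream to the upper end `u`, so that `α_x = α_u` and `c_x = c_u`. -/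
def IsAdmissible (G : L.skeleton.Subgraph) : Prop :=
  ∀ u v, IsDownstream G u v → 0 < streamWeight G u →
    ∀ t ∈ Set.Ico (0 : ℝ) 1,
      0 ≤ inner ℝ (AffineMap.lineMap (S.pos u) (S.pos v) t - rotationCenter G u)
        (S.pos v - S.pos u) / ‖S.pos v - S.pos u‖

variable (L) in
/-- A partition is non-admissible if every admissible cut has a `B`-edge. -/
def NonAdmissible : Prop :=
  ∀ G : L.skeleton.Subgraph, IsCut G → IsAdmissible G → ∃ u v, IsBEdge G u v

/-- `G` connects all points of positive weight: any two of them are joined by a walk in `G`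
itself (without the boundary edges of the polygon). -/
def ConnectsWeighted (G : L.skeleton.Subgraph) : Prop :=
  ∀ i j, 0 < S.weight i → 0 < S.weight j →
    G.spanningCoe.Reachable (Sum.inr i) (Sum.inr j)

end ConvexPartition

/-!
The surface is an explicit triangle with 23 marked points, and everything about admissible cuts
follows from a few facts about *monotone walks*: those whose steps do not approach a given rotation
center. The points `c₁` and `c₂` of positive weight are the marked points 0 and 1. In a component of
a cut that contains a single corner, the path to this corner is directed downstream, so it is
monotone with respect to `c₁`, `c₂` or their midpoint, according to which of `c₁`, `c₂` lie
upstream.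

*Connection.* The marked points 18, ..., 22 form an outer spiral that separates all other marked
points, except one on the boundary side of the spiral, from the corners. Every walk from `c₁` to a
corner that is monotone with respect to `c₁` visits the whole spiral, and likewise for `c₂`. Suppose
that `c₁` and `c₂` lie in different components of an admissible cut. Both components reach corners,
and there are only three, so one of the two has a single corner. Its path to the corner contains the
spiral, and thereby it meets every path from the other component to the boundary, which is absurd
(`ConvexPartition.IsCut.reachable_of_separator`).

*A `B`-edge.* Suppose that an admissible cut has only `A`-edges. Then every component has a single
corner. By the connection property `c₁` and `c₂` share it, and their paths to it merge at a point
`m`: these are monotone with respect to `c₁` and `c₂` before `m`, and with respect to the midpoint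
afterwards (`ConvexPartition.IsCut.exists_meet`). Each center lies in a chamber with the marked
point 6 as the only exit for monotone walks. The chambers are out of reach of the walks from the
other center, so both walks go through 6, and `m` is this point. But walks from 6 that are monotone
with respect to the midpoint are led back into 5, 14 or 15, which the walks from `c₁` or `c₂` to 6
have used already: a contradiction to the cut having no cycles (`SpiralSurface.nonAdmissible`).

That the polygons form a partition is reduced to sign conditions on determinants of integers. The
covering property is deduced from crossing numbers: inner sides are run through once in each
direction, so the crossing numbers of the parts at a point add up to that of the triangle, whereas
the crossing number of a convex polygon vanishes at points outside of it.
-/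

/-! ### Oriented areas in the plane -/

/-- Twice the signed area of the triangle `p q x`: positive when `x` lies to the left of the
line from `p` to `q`. -/
def signedArea (p q x : Plane) : ℝ :=
  (q 0 - p 0) * (x 1 - p 1) - (q 1 - p 1) * (x 0 - p 0)

theorem signedArea_combo (p q x y : Plane) {a b : ℝ} (hab : a + b = 1) :
    signedArea p q (a • x + b • y) = a * signedArea p q x + b * signedArea p q y := by
  obtain rfl : b = 1 - a := by linarith
  simp only [signedArea, PiLp.add_apply, PiLp.smul_apply, smul_eq_mul]
  ring

theorem continuous_signedArea (p q : Plane) : Continuous (signedArea p q) := by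
  unfold signedArea
  fun_prop

theorem convexHull_subset_signedArea_nonneg {s : Set Plane} {p q : Plane}
    (h : ∀ x ∈ s, 0 ≤ signedArea p q x) : ∀ x ∈ convexHull ℝ s, 0 ≤ signedArea p q x := by
  refine fun x hx => convexHull_min (t := {x | 0 ≤ signedArea p q x}) h ?_ hx
  intro x hx y hy a b ha hb hab
  simp only [Set.mem_ofPred_eq] at *
  rw [signedArea_combo p q x y hab]
  positivity

theorem signedArea_swap (p q x : Plane) : signedArea q p x = -signedArea p q x := by
  unfold signedArea
  ring

/-- Points near an interior point of a set on the left of `pq` can be moved to the right, so an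
interior point lies strictly on the left. -/
theorem signedArea_pos_of_mem_interior {s : Set Plane} {p q : Plane} (hpq : p ≠ q)
    (h : ∀ x ∈ s, 0 ≤ signedArea p q x) {x : Plane} (hx : x ∈ interior s) :
    0 < signedArea p q x := by
  let γ : ℝ → Plane := fun t => x + t • !₂[q 1 - p 1, p 0 - q 0]
  have hγ : Continuous γ := by fun_prop
  have hmem : ∀ᶠ t in nhds (0 : ℝ), γ t ∈ interior s := by
    refine hγ.continuousAt.eventually (isOpen_interior.mem_nhds ?_)
    simpa [γ] using hx
  obtain ⟨t, ht, ht0⟩ :=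
    ((hmem.filter_mono nhdsWithin_le_nhds).and (self_mem_nhdsWithin (s := Set.Ioi 0))).exists
  have h1 := h _ (interior_subset ht)
  have h2 : signedArea p q (γ t) =
      signedArea p q x - t * ((q 0 - p 0) ^ 2 + (q 1 - p 1) ^ 2) := by
    simp [γ, signedArea]
    ring
  have h3 : 0 < (q 0 - p 0) ^ 2 + (q 1 - p 1) ^ 2 := by
    by_contra hcon
    have h4 : q 0 - p 0 = 0 := by nlinarith [sq_nonneg (q 0 - p 0), sq_nonneg (q 1 - p 1)]
    have h5 : q 1 - p 1 = 0 := by nlinarith [sq_nonneg (q 0 - p 0), sq_nonneg (q 1 - p 1)]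
    refine hpq ?_
    ext i
    fin_cases i
    · simp; linarith
    · simp; linarith
  have h6 : 0 < t * ((q 0 - p 0) ^ 2 + (q 1 - p 1) ^ 2) := mul_pos ht0 h3
  linarith

theorem disjoint_interior_of_signedArea {s t : Set Plane} {p q : Plane} (hpq : p ≠ q)
    (hs : ∀ x ∈ s, 0 ≤ signedArea p q x) (ht : ∀ x ∈ t, signedArea p q x ≤ 0) :
    Disjoint (interior s) (interior t) := by
  rw [Set.disjoint_left]
  intro x hxs hxt
  have h1 := signedArea_pos_of_mem_interior hpq hs hxs
  have h2 := ht x (interior_subset hxt)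
  linarith

theorem signedArea_eq_zero_of_collinear {p q r : Plane} (h : Collinear ℝ {p, q, r}) :
    signedArea p q r = 0 := by
  rw [collinear_iff_of_mem (p₀ := p) (by simp)] at h
  obtain ⟨v, hv⟩ := h
  obtain ⟨a, rfl⟩ := hv q (by simp)
  obtain ⟨b, rfl⟩ := hv r (by simp)
  simp [signedArea]
  ring

theorem mem_convexHull_triangle {p q r x : Plane} (hpqr : 0 < signedArea p q r)
    (h1 : 0 ≤ signedArea p q x) (h2 : 0 ≤ signedArea q r x) (h3 : 0 ≤ signedArea r p x) :
    x ∈ convexHull ℝ {p, q, r} := by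
  have hsum : signedArea q r x + signedArea r p x + signedArea p q x = signedArea p q r := by
    unfold signedArea
    ring
  have hx : x = (signedArea q r x / signedArea p q r) • p +
      (signedArea r p x / signedArea p q r) • q + (signedArea p q x / signedArea p q r) • r := by
    ext i
    have := hpqr.ne'
    fin_cases i <;> simp <;> field_simp <;> simp only [signedArea] <;> ring
  have hmem := (convex_convexHull ℝ {p, q, r}).sum_mem (t := Finset.univ)
    (w := ![signedArea q r x / signedArea p q r, signedArea r p x / signedArea p q r,
      signedArea p q x / signedArea p q r]) (z := ![p, q, r]) ?_ ?_ ?_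
  · rw [Fin.sum_univ_three] at hmem
    rw [hx]
    exact hmem
  · intro i _
    fin_cases i <;> simp <;> positivity
  · rw [Fin.sum_univ_three]
    simp only [Matrix.cons_val_zero, Matrix.cons_val_one, Matrix.cons_val]
    rw [← add_div, ← add_div, hsum, div_self hpqr.ne']
  · intro i _
    apply subset_convexHull
    fin_cases i <;> simp

theorem mem_interior_convexHull_triangle {p q r x : Plane}
    (h1 : 0 < signedArea p q x) (h2 : 0 < signedArea q r x) (h3 : 0 < signedArea r p x) :
    x ∈ interior (convexHull ℝ {p, q, r}) := by
  have hsum : signedArea q r x + signedArea r p x + signedArea p q x = signedArea p q r := by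
    unfold signedArea
    ring
  have hU : IsOpen {y | 0 < signedArea p q y ∧ 0 < signedArea q r y ∧ 0 < signedArea r p y} :=
    ((isOpen_lt continuous_const (continuous_signedArea p q)).inter
      ((isOpen_lt continuous_const (continuous_signedArea q r)).inter
        (isOpen_lt continuous_const (continuous_signedArea r p))))
  refine mem_interior.2 ⟨_, ?_, hU, ⟨h1, h2, h3⟩⟩
  rintro y ⟨k1, k2, k3⟩
  exact mem_convexHull_triangle (by linarith) k1.le k2.le k3.le

/-- A diagonal of a polygon runs through its interior: if a convex set has points strictly on
both sides of the line `uv`, then the midpoint of `u` and `v` is an interior point. -/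
theorem midpoint_mem_interior {s : Set Plane} (hs : Convex ℝ s) {u v a b : Plane}
    (hu : u ∈ s) (hv : v ∈ s) (ha : a ∈ s) (hb : b ∈ s)
    (hua : 0 < signedArea u v a) (hub : signedArea u v b < 0) :
    midpoint ℝ u v ∈ interior s := by
  have hmid : midpoint ℝ u v = (1 / 2 : ℝ) • u + (1 / 2 : ℝ) • v := by
    rw [midpoint_eq_smul_add, smul_add]
    norm_num
  have h0 (p q : Plane) : signedArea p q p = 0 := by unfold signedArea; ring
  have h1 (p q : Plane) : signedArea p q q = 0 := by unfold signedArea; ring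
  have hrot (p q r : Plane) : signedArea p q r = signedArea q r p := by unfold signedArea; ring
  have hU : IsOpen {y | (0 < signedArea v a y ∧ 0 < signedArea a u y) ∧
      (0 < signedArea u b y ∧ 0 < signedArea b v y)} :=
    ((isOpen_lt continuous_const (continuous_signedArea v a)).inter
      (isOpen_lt continuous_const (continuous_signedArea a u))).inter
    ((isOpen_lt continuous_const (continuous_signedArea u b)).inter
      (isOpen_lt continuous_const (continuous_signedArea b v)))
  refine mem_interior.2 ⟨_, ?_, hU, ?_⟩
  · rintro y ⟨⟨k1, k2⟩, k3, k4⟩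
    rcases le_total 0 (signedArea u v y) with h | h
    · refine convexHull_min ?_ hs (mem_convexHull_triangle hua h k1.le k2.le)
      simp [Set.insert_subset_iff, *]
    · refine convexHull_min ?_ hs (mem_convexHull_triangle (p := v) (q := u) (r := b)
        ?_ ?_ k3.le k4.le)
      · simp [Set.insert_subset_iff, *]
      · rw [signedArea_swap]; linarith
      · rw [signedArea_swap]; linarith
  · have hab : (1 / 2 : ℝ) + 1 / 2 = 1 := by norm_num
    have hsw := signedArea_swap u v b
    refine ⟨⟨?_, ?_⟩, ?_, ?_⟩ <;> rw [hmid, signedArea_combo _ _ _ _ hab]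
    · rw [h0, ← hrot]; linarith
    · rw [h1, hrot]; linarith
    · rw [h0, ← hrot, hsw]; linarith
    · rw [h1, hrot, hsw]; linarith

/-! ### Crossing numbers of vertical rays -/

open Classical in
/-- `1` if `p` lies to the right of the vertical line through `x`, and `0` otherwise: points on
that line count as lying to its left. -/
noncomputable def rightIndicator (x p : Plane) : ℤ := if x 0 < p 0 then 1 else 0

open Classical in
/-- The signed number of crossings of the oriented segment `e.1 e.2` with the vertical ray going
down from `x`: `1` if the segment crosses the ray from left to right, `-1` from right to left. -/
noncomputable def crossing (x : Plane) (e : Plane × Plane) : ℤ :=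
  if ∃ y ∈ segment ℝ e.1 e.2, y 0 = x 0 ∧ y 1 ≤ x 1 then
    rightIndicator x e.2 - rightIndicator x e.1
  else 0

theorem crossing_swap (x : Plane) (e : Plane × Plane) : crossing x e.swap = -crossing x e := by
  unfold crossing
  rw [Prod.fst_swap, Prod.snd_swap, segment_symm ℝ e.2 e.1]
  split_ifs <;> simp

/-- The oriented sides of the polygon whose vertices are listed in cyclic order. -/
def cycleEdges {α : Type*} (l : List α) : List (α × α) :=
  l.zip (l.rotate 1)

theorem sum_cycleEdges_sub {α : Type*} (l : List α) (f : α → ℤ) :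
    ((cycleEdges l).map fun e => f e.2 - f e.1).sum = 0 := by
  have h1 : (cycleEdges l).map Prod.fst = l := List.map_fst_zip (by simp)
  have h2 : (cycleEdges l).map Prod.snd = l.rotate 1 := List.map_snd_zip (by simp)
  have h3 : ((cycleEdges l).map fun e => f e.2 - f e.1).sum =
      (((cycleEdges l).map Prod.snd).map f).sum - (((cycleEdges l).map Prod.fst).map f).sum := by
    generalize cycleEdges l = m
    induction m with
    | nil => simp
    | cons a t ih => simp only [List.map_cons, List.sum_cons, ih]; ring
  rw [h3, h1, h2, ((List.rotate_perm l 1).map f).sum_eq, sub_self]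

theorem exists_mem_segment_vertical {x u v : Plane} (hu : ¬ x 0 < u 0) (hv : x 0 < v 0) :
    ∃ y ∈ segment ℝ u v, y 0 = x 0 := by
  have hpos : 0 < v 0 - u 0 := by linarith
  refine ⟨((v 0 - x 0) / (v 0 - u 0)) • u + ((x 0 - u 0) / (v 0 - u 0)) • v,
    ⟨_, _, div_nonneg (by linarith) hpos.le, div_nonneg (by linarith) hpos.le, ?_, rfl⟩, ?_⟩
  · field_simp; ring
  · simp; field_simp; ring

/-- If `x` lies outside a convex set then, on the vertical line through `x`, the set is either
entirely above or entirely below `x`; so the crossing numbers along a closed polygon in the set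
telescope. -/
theorem sum_crossing_eq_zero {s : Set Plane} (hs : Convex ℝ s) {x : Plane} (hx : x ∉ s)
    {l : List Plane} (hl : ∀ p ∈ l, p ∈ s) : ((cycleEdges l).map (crossing x)).sum = 0 := by
  classical
  have hmem : ∀ e ∈ cycleEdges l, segment ℝ e.1 e.2 ⊆ s := by
    intro e he
    obtain ⟨h1, h2⟩ := List.of_mem_zip (show (e.1, e.2) ∈ l.zip (l.rotate 1) from he)
    exact hs.segment_subset (hl _ h1) (hl _ (List.mem_rotate.1 h2))
  by_cases hbelow : ∃ z ∈ s, z 0 = x 0 ∧ z 1 ≤ x 1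
  · obtain ⟨z, hz, hz0, hz1⟩ := hbelow
    have hall : ∀ y ∈ s, y 0 = x 0 → y 1 ≤ x 1 := by
      intro y hy hy0
      by_contra hlt
      push Not at hlt
      refine hx (hs.segment_subset hz hy ?_)
      have hpos : 0 < y 1 - z 1 := by linarith
      refine ⟨(y 1 - x 1) / (y 1 - z 1), (x 1 - z 1) / (y 1 - z 1),
        div_nonneg (by linarith) hpos.le, div_nonneg (by linarith) hpos.le, ?_, ?_⟩
      · field_simp; ring
      · ext i
        fin_cases i
        · simp [hz0, hy0]; field_simp; ring
        · simp; field_simp; ring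
    have hcr : ∀ e ∈ cycleEdges l, crossing x e = rightIndicator x e.2 - rightIndicator x e.1 := by
      intro e he
      by_cases h : ∃ y ∈ segment ℝ e.1 e.2, y 0 = x 0 ∧ y 1 ≤ x 1
      · simp only [crossing, if_pos h]
      · simp only [crossing, if_neg h, rightIndicator]
        by_cases h1 : x 0 < e.1 0 <;> by_cases h2 : x 0 < e.2 0
        · simp [h1, h2]
        · obtain ⟨y, hy, hy0⟩ := exists_mem_segment_vertical h2 h1
          rw [segment_symm] at hy
          exact absurd ⟨y, hy, hy0, hall y (hmem e he hy) hy0⟩ h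
        · obtain ⟨y, hy, hy0⟩ := exists_mem_segment_vertical h1 h2
          exact absurd ⟨y, hy, hy0, hall y (hmem e he hy) hy0⟩ h
        · simp [h1, h2]
    rw [List.map_congr_left hcr]
    exact sum_cycleEdges_sub l (rightIndicator x)
  · have hcr : ∀ e ∈ cycleEdges l, crossing x e = (fun _ => (0 : ℤ)) e := by
      intro e he
      unfold crossing
      rw [if_neg]
      rintro ⟨y, hy, hy0, hy1⟩
      exact hbelow ⟨y, hmem e he hy, hy0, hy1⟩
    rw [List.map_congr_left hcr]
    simp

/-- The crossing numbers along the boundary of a triangle with horizontal base `p q` add up to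
`1` at a point of its interior. -/
theorem sum_crossing_triangle {p q r x : Plane} (hpq : p 1 = q 1) (hpr : p 0 ≤ r 0)
    (hrq : r 0 ≤ q 0) (h1 : 0 < signedArea p q x) (h2 : 0 < signedArea q r x)
    (h3 : 0 < signedArea r p x) (hp : p 0 < x 0) (hq : x 0 < q 0) :
    crossing x (p, q) + crossing x (q, r) + crossing x (r, p) = 1 := by
  have hqr : crossing x (q, r) = 0 := by
    rw [crossing, if_neg]
    rintro ⟨y, ⟨a, b, ha, hb, hab, rfl⟩, hy0, hy1⟩
    have hy : signedArea q r (a • q + b • r) = 0 := by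
      rw [signedArea_combo _ _ _ _ hab]; unfold signedArea; ring
    generalize a • q + b • r = y at *
    simp only [signedArea] at hy h2
    rw [hy0] at hy
    nlinarith
  have hrp : crossing x (r, p) = 0 := by
    rw [crossing, if_neg]
    rintro ⟨y, ⟨a, b, ha, hb, hab, rfl⟩, hy0, hy1⟩
    have hy : signedArea r p (a • r + b • p) = 0 := by
      rw [signedArea_combo _ _ _ _ hab]; unfold signedArea; ring
    generalize a • r + b • p = y at *
    simp only [signedArea] at hy h3
    rw [hy0] at hy
    nlinarith
  have hpq' : crossing x (p, q) = 1 := by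
    rw [crossing, if_pos]
    · simp [rightIndicator, hq, hp.le]
    · obtain ⟨y, hy, hy0⟩ := exists_mem_segment_vertical (x := x) (u := p) hp.not_gt hq
      refine ⟨y, hy, hy0, ?_⟩
      obtain ⟨a, b, ha, hb, hab, rfl⟩ := hy
      have hy1 : (a • p + b • q) 1 = p 1 := by
        simp only [PiLp.add_apply, PiLp.smul_apply, smul_eq_mul, ← hpq]
        rw [← add_mul, hab, one_mul]
      rw [hy1]
      simp only [signedArea, ← hpq] at h1
      nlinarith
  rw [hpq', hqr, hrp]
  rfl

/-! ### Walks in graphs -/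

namespace SimpleGraph.Walk

variable {V : Type*} {K : SimpleGraph V}

/-- A walk that starts in `Q` and ends outside of `Q` passes through `X`, provided that its steps
lead from `Q` only to `Q ∪ X`. -/
theorem exists_mem_support_of_exit (Q X : V → Prop) {x y : V} (p : K.Walk x y) (hx : Q x)
    (hy : ¬ Q y) (h : ∀ d ∈ p.darts, Q d.fst → Q d.snd ∨ X d.snd) :
    ∃ s ∈ p.support, X s := by
  induction p with
  | nil => exact absurd hx hy
  | @cons u v w huv p ih =>
    rcases h ⟨(u, v), huv⟩ (by simp) hx with hv | hv
    · obtain ⟨s, hs, hXs⟩ := ih hv hy fun d hd => h d (by simp [hd])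
      exact ⟨s, by simp [hs], hXs⟩
    · exact ⟨v, by simp, hv⟩

theorem eq_of_mem_support_append {x m a v : V} {p : K.Walk x m} {r : K.Walk m a}
    (h : (p.append r).IsPath) (hp : v ∈ p.support) (hr : v ∈ r.support) : v = m := by
  rw [isPath_def, support_append] at h
  rw [mem_support_iff] at hr
  rcases hr with hr | hr
  · exact hr
  · exact absurd hr (List.disjoint_of_nodup_append h hp)

theorem fst_ne_of_mem_darts {x y : V} {p : K.Walk x y} (hp : p.IsPath) {d : K.Dart}
    (hd : d ∈ p.darts) : d.fst ≠ y := by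
  induction p with
  | nil => simp at hd
  | @cons u v w huv p ih =>
    rw [cons_isPath_iff] at hp
    rw [darts_cons, List.mem_cons] at hd
    rcases hd with rfl | hd
    · rintro rfl
      exact hp.2 p.end_mem_support
    · exact ih hp.1 hd

/-- In a forest, two paths with a common end merge: they are disjoint up to a vertex `m`, and
coincide from `m` on. -/
theorem exists_meet (hK : K.IsAcyclic) {x y a : V} (p : K.Walk x a) (q : K.Walk y a)
    (hp : p.IsPath) (hq : q.IsPath) :
    ∃ (m : V) (p₁ : K.Walk x m) (q₁ : K.Walk y m) (r : K.Walk m a),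
      p₁.append r = p ∧ q₁.append r = q ∧
      (∀ v ∈ p₁.support, v ∈ q.support → v = m) ∧ ∀ v ∈ q₁.support, v ∈ p.support → v = m := by
  classical
  have key : ∀ {x : V} (p : K.Walk x a), p.IsPath → x ∈ q.support →
      ∃ (m : V) (p₁ : K.Walk x m) (q₁ : K.Walk y m) (r : K.Walk m a),
      p₁.append r = p ∧ q₁.append r = q ∧
      (∀ v ∈ p₁.support, v ∈ q.support → v = m) ∧ ∀ v ∈ q₁.support, v ∈ p.support → v = m := by
    intro x p hp hx
    have hr : q.dropUntil x hx = p := congrArg Subtype.val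
      ((hK.subsingleton_path x a).elim ⟨_, hq.dropUntil hx⟩ ⟨p, hp⟩)
    have hspec : (q.takeUntil x hx).append p = q := by rw [← hr, take_spec]
    refine ⟨x, nil, q.takeUntil x hx, p, rfl, hspec, by simp, ?_⟩
    intro v hv hv'
    rw [← hspec] at hq
    exact eq_of_mem_support_append hq hv hv'
  induction p with
  | nil => exact key nil hp q.end_mem_support
  | @cons u v w huv p ih =>
    by_cases hu : u ∈ q.support
    · exact key _ hp hu
    · obtain ⟨m, p₁, q₁, r, h1, h2, h3, h4⟩ := ih q (cons_isPath_iff _ _ |>.1 hp).1 hq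
        fun p => key p
      refine ⟨m, cons huv p₁, q₁, r, by simp [h1], h2, ?_, ?_⟩
      · intro z hz hzq
        rw [support_cons, List.mem_cons] at hz
        rcases hz with rfl | hz
        · exact absurd hzq hu
        · exact h3 z hz hzq
      · intro z hz hzp
        rw [support_cons, List.mem_cons] at hzp
        rcases hzp with rfl | hzp
        · refine absurd ?_ hu
          rw [← h2, mem_support_append_iff]
          exact Or.inl hz
        · exact h4 z hz hzp

end SimpleGraph.Walk

/-! ### Cuts with weights at two points -/

/-- The weight of `S` is concentrated in `c` and `d`, in equal parts. -/
structure InfSurface.IsTwoPoint (S : InfSurface) (c d : Fin S.numInner) : Prop where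
  ne : c ≠ d
  fst : S.weight c = 1 / 2
  snd : S.weight d = 1 / 2
  other : ∀ i, i ≠ c → i ≠ d → S.weight i = 0

theorem InfSurface.IsTwoPoint.symm {S : InfSurface} {c d : Fin S.numInner}
    (h : S.IsTwoPoint c d) : S.IsTwoPoint d c :=
  ⟨h.ne.symm, h.snd, h.fst, fun i h1 h2 => h.other i h2 h1⟩

namespace ConvexPartition

open SimpleGraph

variable {S : InfSurface} {L : ConvexPartition S} {G : L.skeleton.Subgraph}

theorem spanningCoe_le_withBoundary : G.spanningCoe ≤ (withBoundary G).spanningCoe :=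
  fun _ _ h => Or.inl h

/-- A walk in `G ∪ ∂P` that leads to `∂P` uses only edges of `G` up to the first corner on it. -/
theorem exists_walk_to_corner {v : S.Vert} {j : Fin S.numCorners}
    (w : (withBoundary G).spanningCoe.Walk v (Sum.inl j)) :
    ∃ (j' : Fin S.numCorners) (q : G.spanningCoe.Walk v (Sum.inl j')),
      q.support ⊆ w.support ∧ q.edges ⊆ w.edges := by
  generalize ha : (Sum.inl j : S.Vert) = a at w
  induction w with
  | nil => subst ha; exact ⟨j, .nil, by simp, by simp⟩
  | @cons u v w huv p ih =>
    rcases huv with h | h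
    · obtain ⟨j', q, h1, h2⟩ := ih ha
      exact ⟨j', .cons h q, List.cons_subset_cons _ h1, List.cons_subset_cons _ h2⟩
    · obtain ⟨j', rfl⟩ := h.2.1
      exact ⟨j', .nil, by simp, by simp⟩

theorem IsCut.exists_reachable_corner (hG : IsCut G) {v : S.Vert} (hv : v ∈ G.verts) :
    ∃ j, G.spanningCoe.Reachable v (Sum.inl j) := by
  have h3 := S.three_le
  let j₀ : Fin S.numCorners := ⟨0, by omega⟩
  have hj : (Sum.inl j₀ : S.Vert) ∈ (withBoundary G).verts := Or.inr ⟨j₀, rfl⟩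
  have hv' : v ∈ (withBoundary G).verts := Or.inl hv
  obtain ⟨w⟩ := hG.connected.preconnected ⟨v, hv'⟩ ⟨_, hj⟩
  let f : (withBoundary G).coe →g (withBoundary G).spanningCoe :=
    ⟨Subtype.val, fun h => h⟩
  obtain ⟨j', q, -, -⟩ := exists_walk_to_corner (w.map f : (withBoundary G).spanningCoe.Walk v _)
  exact ⟨j', ⟨q⟩⟩

variable (G) in
/-- `j` is the only corner in the component of `v` in `G`. -/
def IsOutlet (v : S.Vert) (j : Fin S.numCorners) : Prop :=
  G.spanningCoe.Reachable v (Sum.inl j) ∧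
    ∀ j', G.spanningCoe.Reachable v (Sum.inl j') → j' = j

theorem IsCut.isDownstream_of_isOutlet (hG : IsCut G) {u v : S.Vert} {j : Fin S.numCorners}
    (ho : IsOutlet G u j) (huv : G.Adj u v) (p : G.spanningCoe.Walk v (Sum.inl j))
    (hp : u ∉ p.support) : IsDownstream G u v := by
  refine ⟨huv, fun j' hr => ?_⟩
  rw [reachable_deleteEdges_iff_exists_walk] at hr
  obtain ⟨w, hw⟩ := hr
  obtain ⟨j'', q, -, hq⟩ := exists_walk_to_corner w
  obtain rfl := ho.2 j'' ⟨q⟩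
  have hb := isAcyclic_iff_forall_adj_isBridge.1 hG.acyclic (show G.spanningCoe.Adj u v from huv)
  have hmem := isBridge_iff_forall_walk_mem_edges.1 hb (q.append p.reverse)
  rw [Walk.edges_append, Walk.edges_reverse, List.mem_append, List.mem_reverse] at hmem
  rcases hmem with h | h
  · exact hw (hq h)
  · exact hp (p.fst_mem_support_of_mem_edges h)

/-- In a component of `G` with a single corner all edges of the path to this corner are directed
downstream. -/
theorem IsCut.isDownstream_of_mem_darts (hG : IsCut G) {v : S.Vert} {j : Fin S.numCorners}
    (ho : IsOutlet G v j) (p : G.spanningCoe.Walk v (Sum.inl j)) (hp : p.IsPath) :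
    ∀ d ∈ p.darts, IsDownstream G d.fst d.snd := by
  generalize ha : (Sum.inl j : S.Vert) = a at p
  induction p with
  | nil => simp
  | @cons u v w huv p ih =>
    subst ha
    rw [Walk.cons_isPath_iff] at hp
    intro d hd
    rw [Walk.darts_cons, List.mem_cons] at hd
    rcases hd with rfl | hd
    · exact hG.isDownstream_of_isOutlet ho huv p hp.2
    · exact ih ⟨⟨p⟩, fun j' hj' => ho.2 j' (huv.reachable.trans hj')⟩ rfl hp.1 d hd

theorem IsCut.upstream_of_mem_support (hG : IsCut G) {w x : S.Vert} {j : Fin S.numCorners}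
    (ho : IsOutlet G w j) (hw : w ∈ G.verts) {p : G.spanningCoe.Walk w (Sum.inl j)}
    (hp : p.IsPath) (hx : x ∈ p.support) : Upstream G w x := by
  classical
  refine ⟨Or.inl hw, fun j' q => ?_⟩
  obtain ⟨j'', r, hr, -⟩ := exists_walk_to_corner q
  obtain rfl := ho.2 j'' ⟨r⟩
  have heq : r.bypass = p := congrArg Subtype.val
    ((hG.acyclic.subsingleton_path _ _).elim ⟨_, r.bypass_isPath⟩ ⟨p, hp⟩)
  rw [← heq] at hx
  exact hr (r.support_bypass_subset_support hx)

theorem not_upstream_of_notMem_support {w x : S.Vert} {j : Fin S.numCorners}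
    (p : G.spanningCoe.Walk w (Sum.inl j)) (hx : x ∉ p.support) : ¬ Upstream G w x := by
  intro h
  have := h.2 j (p.mapLe spanningCoe_le_withBoundary)
  rw [Walk.support_mapLe_eq_support] at this
  exact hx this

/-- At the upper end of a downstream edge the admissibility condition is the sharpest. -/
theorem IsAdmissible.inner_nonneg (h : IsAdmissible G) {u v : S.Vert} (huv : IsDownstream G u v)
    (hpos : 0 < streamWeight G u) :
    0 ≤ inner ℝ (S.pos u - rotationCenter G u) (S.pos v - S.pos u) := by
  have h0 := h u v huv hpos 0 (by simp)
  rw [AffineMap.lineMap_apply_zero] at h0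
  rcases (norm_nonneg (S.pos v - S.pos u)).eq_or_lt with hn | hn
  · rw [norm_eq_zero.1 hn.symm, inner_zero_right]
  · rw [le_div_iff₀ hn, zero_mul] at h0
    exact h0

open Classical in
theorem sum_upstream {c d : Fin S.numInner} (hS : S.IsTwoPoint c d) {M : Type*}
    [AddCommGroup M] [Module ℝ M] (f : Fin S.numInner → M) (x : S.Vert) :
    ∑ i with Upstream G (Sum.inr i) x, S.weight i • f i =
      (if Upstream G (Sum.inr c) x then (1 / 2 : ℝ) • f c else 0) +
      if Upstream G (Sum.inr d) x then (1 / 2 : ℝ) • f d else 0 := by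
  rw [Finset.sum_filter, Finset.sum_eq_add c d hS.ne, hS.fst, hS.snd]
  · intro i _ hi
    rw [hS.other i hi.1 hi.2, zero_smul, ite_self]
  · simp
  · simp

theorem IsAdmissible.inner_nonneg_of_one (h : IsAdmissible G) {c d : Fin S.numInner}
    (hS : S.IsTwoPoint c d) {u v : S.Vert} (huv : IsDownstream G u v)
    (hc : Upstream G (Sum.inr c) u) (hd : ¬ Upstream G (Sum.inr d) u) :
    0 ≤ inner ℝ (S.pos u - S.inner c) (S.pos v - S.pos u) := by
  classical
  have hw : streamWeight G u = 1 / 2 := by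
    have := sum_upstream (G := G) hS (fun _ => (1 : ℝ)) u
    simp only [smul_eq_mul, mul_one, if_pos hc, if_neg hd, add_zero] at this
    exact this
  have hr : rotationCenter G u = S.inner c := by
    have := sum_upstream (G := G) hS S.inner u
    simp only [if_pos hc, if_neg hd, add_zero] at this
    rw [rotationCenter, hw, this, smul_smul]
    norm_num
  rw [← hr]
  exact h.inner_nonneg huv (by rw [hw]; norm_num)

theorem IsAdmissible.inner_nonneg_of_both (h : IsAdmissible G) {c d : Fin S.numInner}
    (hS : S.IsTwoPoint c d) {u v : S.Vert} (huv : IsDownstream G u v)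
    (hc : Upstream G (Sum.inr c) u) (hd : Upstream G (Sum.inr d) u) :
    0 ≤ inner ℝ (S.pos u - midpoint ℝ (S.inner c) (S.inner d)) (S.pos v - S.pos u) := by
  classical
  have hw : streamWeight G u = 1 := by
    have := sum_upstream (G := G) hS (fun _ => (1 : ℝ)) u
    simp only [smul_eq_mul, mul_one, if_pos hc, if_pos hd] at this
    rw [streamWeight, this]
    norm_num
  have hr : rotationCenter G u = midpoint ℝ (S.inner c) (S.inner d) := by
    have := sum_upstream (G := G) hS S.inner u
    simp only [if_pos hc, if_pos hd] at this
    rw [rotationCenter, hw, this, midpoint_eq_smul_add, ← smul_add]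
    norm_num
  rw [← hr]
  exact h.inner_nonneg huv (by rw [hw]; norm_num)

/-- The path from `c` to the boundary is monotone with respect to `c`, if the component of `c`
has only one corner and does not contain `d`. -/
theorem IsCut.inner_nonneg_of_not_reachable (hG : IsCut G) (h : IsAdmissible G)
    {c d : Fin S.numInner} (hS : S.IsTwoPoint c d)
    (hcd : ¬ G.spanningCoe.Reachable (Sum.inr c) (Sum.inr d))
    {j : Fin S.numCorners} (ho : IsOutlet G (Sum.inr c) j)
    {p : G.spanningCoe.Walk (Sum.inr c) (Sum.inl j)} (hp : p.IsPath) :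
    ∀ e ∈ p.darts, 0 ≤ inner ℝ (S.pos e.fst - S.inner c) (S.pos e.snd - S.pos e.fst) := by
  classical
  intro e he
  have hc : Sum.inr c ∈ G.verts := hG.weighted_mem c (by rw [hS.fst]; norm_num)
  have hd : Sum.inr d ∈ G.verts := hG.weighted_mem d (by rw [hS.snd]; norm_num)
  have hmem := p.dart_fst_mem_support_of_mem_darts he
  refine h.inner_nonneg_of_one hS (hG.isDownstream_of_mem_darts ho p hp e he)
    (hG.upstream_of_mem_support ho hc hp hmem) ?_
  obtain ⟨j', ⟨q⟩⟩ := hG.exists_reachable_corner hd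
  refine not_upstream_of_notMem_support q fun hq => hcd ?_
  exact (p.takeUntil _ hmem).reachable.trans (q.takeUntil _ hq).reachable.symm

/-- If all edges of `G` are `A`-edges, then every component of `G` has only one corner. -/
theorem eq_of_reachable_corners (hA : ∀ u v, ¬ IsBEdge G u v) {i j : Fin S.numCorners}
    (h : G.spanningCoe.Reachable (Sum.inl i) (Sum.inl j)) : i = j := by
  classical
  by_contra hij
  obtain ⟨p, hp⟩ := h.exists_isPath
  cases p with
  | nil => exact hij rfl
  | @cons _ v _ huv p =>
    rw [Walk.cons_isPath_iff] at hp
    refine hA _ _ ⟨huv, ?_⟩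
    rintro (hd | hd)
    · exact hd.2 i .rfl
    · refine hd.2 j ?_
      rw [reachable_deleteEdges_iff_exists_walk]
      refine ⟨p.mapLe spanningCoe_le_withBoundary, fun hmem => hp.2 ?_⟩
      rw [Walk.edges_mapLe_eq_edges] at hmem
      exact p.snd_mem_support_of_mem_edges hmem

/-- If the points `c` and `d` lie in a component of `G` with a single corner, then the paths from
`c` and `d` to this corner merge at some vertex `m`; they are monotone with respect to `c` and
`d`, respectively, up to `m`, and with respect to the midpoint of `c` and `d` from `m` on. -/
theorem IsCut.exists_meet (hG : IsCut G) (h : IsAdmissible G)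
    {c d : Fin S.numInner} (hS : S.IsTwoPoint c d) {j : Fin S.numCorners}
    (hoc : IsOutlet G (Sum.inr c) j) (hod : IsOutlet G (Sum.inr d) j) :
    ∃ (m : S.Vert) (p : G.spanningCoe.Walk (Sum.inr c) m) (q : G.spanningCoe.Walk (Sum.inr d) m)
      (r : G.spanningCoe.Walk m (Sum.inl j)),
      (∀ v ∈ p.support, v ∈ q.support → v = m) ∧
      (∀ v ∈ p.support, v ∈ r.support → v = m) ∧
      (∀ v ∈ q.support, v ∈ r.support → v = m) ∧
      (∀ e ∈ p.darts, 0 ≤ inner ℝ (S.pos e.fst - S.inner c) (S.pos e.snd - S.pos e.fst)) ∧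
      (∀ e ∈ q.darts, 0 ≤ inner ℝ (S.pos e.fst - S.inner d) (S.pos e.snd - S.pos e.fst)) ∧
      ∀ e ∈ r.darts, 0 ≤ inner ℝ (S.pos e.fst - midpoint ℝ (S.inner c) (S.inner d))
        (S.pos e.snd - S.pos e.fst) := by
  classical
  have hc : Sum.inr c ∈ G.verts := hG.weighted_mem c (by rw [hS.fst]; norm_num)
  have hd : Sum.inr d ∈ G.verts := hG.weighted_mem d (by rw [hS.snd]; norm_num)
  obtain ⟨p, hp⟩ := hoc.1.exists_isPath
  obtain ⟨q, hq⟩ := hod.1.exists_isPath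
  obtain ⟨m, p₁, q₁, r, rfl, rfl, h1, h2⟩ := Walk.exists_meet hG.acyclic p q hp hq
  have hp₁ : p₁.IsPath := hp.of_append_left
  have hq₁ : q₁.IsPath := hq.of_append_left
  have hdp := hG.isDownstream_of_mem_darts hoc _ hp
  have hdq := hG.isDownstream_of_mem_darts hod _ hq
  refine ⟨m, p₁, q₁, r, ?_, fun v => Walk.eq_of_mem_support_append hp,
    fun v => Walk.eq_of_mem_support_append hq, ?_, ?_, ?_⟩
  · intro v hv hv'
    exact h1 v hv (by rw [Walk.mem_support_append_iff]; exact Or.inl hv')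
  · intro e he
    have hs := p₁.dart_fst_mem_support_of_mem_darts he
    refine h.inner_nonneg_of_one hS (hdp e (by simp [he]))
      (hG.upstream_of_mem_support hoc hc hp (by rw [Walk.mem_support_append_iff]; exact Or.inl hs))
      (not_upstream_of_notMem_support (q₁.append r) fun hmem => ?_)
    exact Walk.fst_ne_of_mem_darts hp₁ he (h1 _ hs hmem)
  · intro e he
    have hs := q₁.dart_fst_mem_support_of_mem_darts he
    refine h.inner_nonneg_of_one hS.symm (hdq e (by simp [he]))
      (hG.upstream_of_mem_support hod hd hq (by rw [Walk.mem_support_append_iff]; exact Or.inl hs))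
      (not_upstream_of_notMem_support (p₁.append r) fun hmem => ?_)
    exact Walk.fst_ne_of_mem_darts hq₁ he (h2 _ hs hmem)
  · intro e he
    have hs := r.dart_fst_mem_support_of_mem_darts he
    exact h.inner_nonneg_of_both hS (hdp e (by simp [he]))
      (hG.upstream_of_mem_support hoc hc hp (by rw [Walk.mem_support_append_iff]; exact Or.inr hs))
      (hG.upstream_of_mem_support hod hd hq (by rw [Walk.mem_support_append_iff]; exact Or.inr hs))

/-- If every admissible path from `c`, and every admissible path from `d`, runs through all of a
set `X` of vertices that separates `c` and `d` from the corners, then an admissible cut joins `c`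
and `d`: of two different components one has a single corner, since there are only three corners,
and its part of `X` cuts the other component off from the boundary. -/
theorem IsCut.reachable_of_separator (hG : IsCut G) (h : IsAdmissible G)
    {c d : Fin S.numInner} (hS : S.IsTwoPoint c d) (h3 : S.numCorners = 3) (W X : S.Vert → Prop)
    (hWc : W (Sum.inr c)) (hWd : W (Sum.inr d)) (hW : ∀ j, ¬ W (Sum.inl j))
    (hsep : ∀ u v, L.skeleton.Adj u v → W u → W v ∨ X v)
    (hXc : ∀ (j : Fin S.numCorners) (p : G.spanningCoe.Walk (Sum.inr c) (Sum.inl j)),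
      (∀ e ∈ p.darts, 0 ≤ inner ℝ (S.pos e.fst - S.inner c) (S.pos e.snd - S.pos e.fst)) →
      ∀ s, X s → s ∈ p.support)
    (hXd : ∀ (j : Fin S.numCorners) (p : G.spanningCoe.Walk (Sum.inr d) (Sum.inl j)),
      (∀ e ∈ p.darts, 0 ≤ inner ℝ (S.pos e.fst - S.inner d) (S.pos e.snd - S.pos e.fst)) →
      ∀ s, X s → s ∈ p.support) :
    G.spanningCoe.Reachable (Sum.inr c) (Sum.inr d) := by
  classical
  by_contra hcd
  have hc : Sum.inr c ∈ G.verts := hG.weighted_mem c (by rw [hS.fst]; norm_num)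
  have hd : Sum.inr d ∈ G.verts := hG.weighted_mem d (by rw [hS.snd]; norm_num)
  -- a component with a single corner cuts the other one off
  have key : ∀ {c d : Fin S.numInner}, S.IsTwoPoint c d →
      ¬ G.spanningCoe.Reachable (Sum.inr c) (Sum.inr d) → W (Sum.inr d) → Sum.inr d ∈ G.verts →
      (∀ (j : Fin S.numCorners) (p : G.spanningCoe.Walk (Sum.inr c) (Sum.inl j)),
        (∀ e ∈ p.darts, 0 ≤ inner ℝ (S.pos e.fst - S.inner c) (S.pos e.snd - S.pos e.fst)) →
        ∀ s, X s → s ∈ p.support) →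
      ∀ j, ¬ IsOutlet G (Sum.inr c) j := by
    intro c d hS hcd hWd hd hXc j ho
    obtain ⟨p, hp⟩ := ho.1.exists_isPath
    obtain ⟨j', ⟨q⟩⟩ := hG.exists_reachable_corner hd
    obtain ⟨s, hs, hXs⟩ := q.exists_mem_support_of_exit W X hWd (hW j')
      fun e _ he => hsep _ _ (G.adj_sub e.adj) he
    have hsp := hXc j p (hG.inner_nonneg_of_not_reachable h hS hcd ho hp) s hXs
    exact hcd ((p.takeUntil _ hsp).reachable.trans (q.takeUntil _ hs).reachable.symm)
  have two : ∀ {v : S.Vert}, v ∈ G.verts → (∀ j, ¬ IsOutlet G v j) →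
      ∃ i j, i ≠ j ∧ G.spanningCoe.Reachable v (Sum.inl i) ∧
        G.spanningCoe.Reachable v (Sum.inl j) := by
    intro v hv hno
    obtain ⟨i, hi⟩ := hG.exists_reachable_corner hv
    have := hno i
    simp only [IsOutlet, hi, true_and, not_forall] at this
    obtain ⟨j, hj, hji⟩ := this
    exact ⟨i, j, Ne.symm hji, hi, hj⟩
  obtain ⟨i, j, hij, hi, hj⟩ := two hc (key hS hcd hWd hd hXc)
  obtain ⟨k, l, hkl, hk, hl⟩ := two hd (key hS.symm (fun h => hcd h.symm) hWc hc hXd)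
  have hik : i ≠ k := by rintro rfl; exact hcd (hi.trans hk.symm)
  have hil : i ≠ l := by rintro rfl; exact hcd (hi.trans hl.symm)
  have hjk : j ≠ k := by rintro rfl; exact hcd (hj.trans hk.symm)
  have hjl : j ≠ l := by rintro rfl; exact hcd (hj.trans hl.symm)
  omega

end ConvexPartition

/-! ### Coordinates and determinants -/

namespace SpiralSurface

/-- Labels of the vertices: three corners and 23 marked points. -/
abbrev Label : Type := Fin 3 ⊕ Fin 23

/-- The coordinates of the corners, in units of `1 / 100000`. -/
def cornerCoord : Fin 3 → ℤ × ℤ :=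
  ![(0, 0), (100000, 0), (69920, 30614)]

/-- The coordinates of the marked points, in units of `1 / 100000`. The points 0 and 1 carry the
weight; 2, ..., 5 and 11, ..., 15 form chambers around 0 and 1, with the common exit 6. The points
18, ..., 22 form the spiral, which monotone walks from 0 reach through 7 and 8, and those from 1
through 9. The remaining points serve to divide the rest of the triangle into convex parts. -/
def innerCoord : Fin 23 → ℤ × ℤ :=
  ![(70429, 11130), (70901, 11303), (70424, 11127), (70404, 11138), (70421, 11201),
    (70675, 11246), (70782, 11157), (70858, 11301), (71054, 10846), (70661, 10923),
    (70881, 11267), (70904, 11301), (70908, 11306), (70902, 11326), (70843, 11337),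
    (70774, 11237), (70289, 10734), (72280, 1119), (71227, 10432), (73964, 10804),
    (75298, 17982), (62770, 27327), (1672, 65)]

/-- The coordinates of the vertices, in units of `1 / 100000`. -/
def coord : Label → ℤ × ℤ := Sum.elim cornerCoord innerCoord

/-- The parts of the partition: the vertices of each in counterclockwise order. -/
def faces : List (List Label) := [
  [.inr 0, .inr 3, .inr 2], [.inr 0, .inr 5, .inr 4, .inr 3],
  [.inr 0, .inr 2, .inr 9, .inr 6, .inr 5], [.inr 2, .inr 3, .inr 16, .inr 18, .inr 9],
  [.inr 9, .inr 18, .inr 8, .inr 7, .inr 6], [.inr 7, .inr 8, .inr 10, .inr 14],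
  [.inr 6, .inr 7, .inr 14, .inr 15], [.inr 14, .inr 10, .inr 11, .inr 1],
  [.inr 1, .inr 11, .inr 12, .inr 13], [.inr 1, .inr 13, .inr 14],
  [.inr 10, .inr 8, .inr 18, .inr 12, .inr 11], [.inr 12, .inr 18, .inr 19, .inr 13],
  [.inr 13, .inr 19, .inr 20, .inr 14], [.inr 14, .inr 20, .inr 21, .inr 15],
  [.inr 15, .inr 21, .inr 5, .inr 6], [.inr 5, .inr 21, .inr 22, .inr 4],
  [.inr 4, .inr 22, .inr 16, .inr 3], [.inr 22, .inr 18, .inr 16],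
  [.inr 18, .inr 22, .inr 17, .inr 19], [.inr 19, .inr 17, .inl 1, .inr 20],
  [.inr 20, .inl 1, .inl 2, .inr 21], [.inr 21, .inl 2, .inl 0, .inr 22],
  [.inr 22, .inl 0, .inl 1, .inr 17]]

instance : LawfulBEq Label where
  rfl {a} := by
    rcases a with a | a
    · exact beq_self_eq_true a
    · exact beq_self_eq_true a
  eq_of_beq {a b} h := by
    rcases a with a | a <;> rcases b with b | b
    · exact congrArg _ (eq_of_beq (α := Fin 3) h)
    · exact absurd h Bool.false_ne_true
    · exact absurd h Bool.false_ne_true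
    · exact congrArg _ (eq_of_beq (α := Fin 23) h)

/-- Twice the signed area of the triangle `u v w`, in units of `10⁻¹⁰`. -/
def det (u v w : Label) : ℤ :=
  ((coord v).1 - (coord u).1) * ((coord w).2 - (coord u).2) -
    ((coord v).2 - (coord u).2) * ((coord w).1 - (coord u).1)

/-- `u v` is a side, rather than a diagonal, of some part: this part lies on one side of `u v`. -/
def IsSide (u v : Label) : Prop :=
  u ≠ v ∧ ∃ l ∈ faces, u ∈ l ∧ v ∈ l ∧ ((∀ a ∈ l, 0 ≤ det u v a) ∨ ∀ a ∈ l, det u v a ≤ 0)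

instance (u v : Label) : Decidable (IsSide u v) := by
  unfold IsSide
  infer_instance

/-- Moving from `u` to `v` does not approach the point `z / 2`, at first and hence at all. -/
def IsStep (z : ℤ × ℤ) (u v : Label) : Prop :=
  0 ≤ (2 * (coord u).1 - z.1) * ((coord v).1 - (coord u).1) +
    (2 * (coord u).2 - z.2) * ((coord v).2 - (coord u).2)

instance (z : ℤ × ℤ) (u v : Label) : Decidable (IsStep z u v) := by
  unfold IsStep
  infer_instance

/-- Monotone steps with respect to `z / 2` lead from `Q` only to `Q ∪ X`. -/
def Confined (z : ℤ × ℤ) (Q X : List Label) : Prop :=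
  ∀ u ∈ Q, ∀ v, IsSide u v → IsStep z u v → v ∈ Q ∨ v ∈ X

instance (z : ℤ × ℤ) (Q X : List Label) : Decidable (Confined z Q X) := by
  unfold Confined
  infer_instance

theorem face_corner_pos : ∀ l ∈ faces, ∀ v ∈ l, ∃ p ∈ l, ∃ q ∈ l,
    det p q v < 0 ∧ ∀ x ∈ l, x ≠ v → 0 ≤ det p q x := by
  decide +kernel

theorem three_le_toFinset_card : ∀ l ∈ faces, 3 ≤ l.toFinset.card := by
  decide +kernel

theorem exists_separating_side_vertex : ∀ l ∈ faces, ∀ v : Label, v ∉ l →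
    ∃ e ∈ cycleEdges l, det e.1 e.2 v < 0 ∧ ∀ x ∈ l, 0 ≤ det e.1 e.2 x := by
  decide +kernel

theorem exists_separating_side : ∀ l ∈ faces, ∀ l' ∈ faces, l ≠ l' →
    ∃ e ∈ cycleEdges l ++ (cycleEdges l').map Prod.swap, coord e.1 ≠ coord e.2 ∧
      (∀ x ∈ l', det e.1 e.2 x ≤ 0) ∧ ∀ x ∈ l, 0 ≤ det e.1 e.2 x := by
  decide +kernel

theorem mem_some_face : ∀ v : Label, ∃ l ∈ faces, v ∈ l := by
  decide +kernel

theorem det_ne_zero : ∀ i j k : Fin 23, i ≠ j → j ≠ k → i ≠ k →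
    det (.inr i) (.inr j) (.inr k) ≠ 0 := by
  decide +kernel

theorem det_corner_pos : ∀ i : Fin 23, 0 < det (.inl 0) (.inl 1) (.inr i) ∧
    0 < det (.inl 1) (.inl 2) (.inr i) ∧ 0 < det (.inl 2) (.inl 0) (.inr i) := by
  decide +kernel

/-- The oriented sides of the outer triangle. -/
def outerEdges : List (Label × Label) := [(.inl 0, .inl 1), (.inl 1, .inl 2), (.inl 2, .inl 0)]

/-- The oriented sides of the parts that are not on the boundary. -/
def innerEdges : List (Label × Label) := (faces.flatMap cycleEdges).filter fun e => e ∉ outerEdges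

theorem edges_perm : (faces.flatMap cycleEdges).Perm (outerEdges ++ innerEdges) := by
  decide +kernel

theorem innerEdges_swap_perm : (innerEdges.map Prod.swap).Perm innerEdges := by
  decide +kernel

theorem innerCoord_injective : ∀ i j : Fin 23, innerCoord i = innerCoord j → i = j := by
  decide +kernel

/-! ### The surface and its partition -/

/-- The position of a vertex in the plane. -/
noncomputable def pt (v : Label) : Plane :=
  !₂[((coord v).1 : ℝ) / 100000, ((coord v).2 : ℝ) / 100000]

@[simp] theorem pt_zero (v : Label) : pt v 0 = ((coord v).1 : ℝ) / 100000 := rfl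

@[simp] theorem pt_one (v : Label) : pt v 1 = ((coord v).2 : ℝ) / 100000 := rfl

theorem signedArea_pt (u v w : Label) :
    signedArea (pt u) (pt v) (pt w) = (det u v w : ℝ) / 10 ^ 10 := by
  simp only [signedArea, pt_zero, pt_one, det]
  push_cast
  ring

theorem signedArea_pt_nonneg {u v w : Label} (h : 0 ≤ det u v w) :
    0 ≤ signedArea (pt u) (pt v) (pt w) := by
  rw [signedArea_pt]
  have : (0 : ℝ) ≤ det u v w := by exact_mod_cast h
  positivity

theorem signedArea_pt_pos {u v w : Label} (h : 0 < det u v w) :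
    0 < signedArea (pt u) (pt v) (pt w) := by
  rw [signedArea_pt]
  have : (0 : ℝ) < det u v w := by exact_mod_cast h
  positivity

theorem signedArea_pt_neg {u v w : Label} (h : det u v w < 0) :
    signedArea (pt u) (pt v) (pt w) < 0 := by
  rw [signedArea_pt]
  have : (det u v w : ℝ) < 0 := by exact_mod_cast h
  exact div_neg_of_neg_of_pos this (by positivity)

theorem signedArea_pt_nonpos {u v w : Label} (h : det u v w ≤ 0) :
    signedArea (pt u) (pt v) (pt w) ≤ 0 := by
  rw [signedArea_pt]
  have : (det u v w : ℝ) ≤ 0 := by exact_mod_cast h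
  exact div_nonpos_of_nonpos_of_nonneg this (by positivity)

theorem coord_eq_of_pt_eq {u v : Label} (h : pt u = pt v) : coord u = coord v := by
  have h0 := congrArg (fun p : Plane => p 0) h
  have h1 := congrArg (fun p : Plane => p 1) h
  simp only [pt_zero, pt_one, ne_eq, OfNat.ofNat_ne_zero, not_false_eq_true,
    div_left_inj', Int.cast_inj] at h0 h1
  exact Prod.ext h0 h1

theorem notMem_convexHull_of_det {s : Set Label} {p q v : Label} (hv : det p q v < 0)
    (h : ∀ x ∈ s, 0 ≤ det p q x) : pt v ∉ convexHull ℝ (pt '' s) := by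
  intro hmem
  refine (signedArea_pt_neg hv).not_ge (convexHull_subset_signedArea_nonneg ?_ _ hmem)
  rintro _ ⟨x, hx, rfl⟩
  exact signedArea_pt_nonneg (h x hx)

/-- Vertices are in convex position if each of them is cut off from the others by a line through two
vertices. -/
theorem convexIndependent_pt {ι : Type*} (f : ι → Label)
    (h : ∀ i, ∃ p q, det p q (f i) < 0 ∧ ∀ k, k ≠ i → 0 ≤ det p q (f k)) :
    ConvexIndependent ℝ fun i => pt (f i) := by
  rw [convexIndependent_iff_notMem_convexHull_sdiff]
  intro i s hmem
  obtain ⟨p, q, hneg, hpos⟩ := h i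
  rw [show (fun i => pt (f i)) '' (s \ {i}) = pt '' (f '' (s \ {i})) by
    rw [Set.image_image]] at hmem
  refine notMem_convexHull_of_det hneg ?_ hmem
  rintro _ ⟨k, hk, rfl⟩
  exact hpos k hk.2

theorem range_corner : Set.range (fun i : Fin 3 => pt (.inl i)) =
    {pt (.inl 0), pt (.inl 1), pt (.inl 2)} := by
  ext x
  simp [Fin.exists_fin_succ, eq_comm]

theorem corner_mem (i : Fin 3) :
    pt (.inl i) ∈ convexHull ℝ (Set.range fun i : Fin 3 => pt (.inl i)) :=
  subset_convexHull ℝ _ ⟨i, rfl⟩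

theorem dist_pt (u v : Label) : dist (pt u) (pt v) =
    √((((coord u).1 - (coord v).1) ^ 2 + ((coord u).2 - (coord v).2) ^ 2 : ℤ) / 10 ^ 10) := by
  rw [EuclideanSpace.dist_eq, Fin.sum_univ_two]
  simp only [Real.dist_eq, sq_abs, pt_zero, pt_one]
  push_cast
  ring_nf

theorem corner_sq_dist_le : ∀ i j : Fin 3,
    ((coord (.inl i)).1 - (coord (.inl j)).1) ^ 2 + ((coord (.inl i)).2 - (coord (.inl j)).2) ^ 2 ≤
      10 ^ 10 := by
  decide +kernel

theorem diam_eq_one :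
    Metric.diam (convexHull ℝ (Set.range fun i : Fin 3 => pt (.inl i))) = 1 := by
  rw [convexHull_diam]
  apply le_antisymm
  · refine Metric.diam_le_of_forall_dist_le zero_le_one ?_
    rintro _ ⟨i, rfl⟩ _ ⟨j, rfl⟩
    simp only
    rw [dist_pt]
    rw [Real.sqrt_le_one, div_le_one (by positivity)]
    exact_mod_cast corner_sq_dist_le i j
  · have h : dist (pt (.inl 0)) (pt (.inl 1)) = 1 := by
      rw [dist_pt]
      simp [coord, cornerCoord]
      norm_num
    rw [← h]
    exact Metric.dist_le_diam_of_mem (Set.finite_range _).isBounded ⟨0, rfl⟩ ⟨1, rfl⟩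

theorem inner_mem (i : Fin 23) :
    pt (.inr i) ∈ interior (convexHull ℝ (Set.range fun i : Fin 3 => pt (.inl i))) := by
  rw [range_corner]
  obtain ⟨h1, h2, h3⟩ := det_corner_pos i
  exact mem_interior_convexHull_triangle (signedArea_pt_pos h1) (signedArea_pt_pos h2)
    (signedArea_pt_pos h3)

/-- The surface: the triangle with the marked points, and with the weights `1 / 2` at the first
two of them. -/
@[reducible] noncomputable def surface : InfSurface where
  numCorners := 3
  numInner := 23
  corner i := pt (.inl i)
  inner i := pt (.inr i)
  weight i := if i = 0 ∨ i = 1 then 1 / 2 else 0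
  three_le := le_rfl
  corner_convexIndependent := convexIndependent_pt _ (by decide +kernel)
  diam_eq_one := diam_eq_one
  inner_mem := inner_mem
  inner_injective i j h := innerCoord_injective i j (coord_eq_of_pt_eq h)
  inner_general i j k hij hjk hik h := by
    have h0 := signedArea_eq_zero_of_collinear h
    rw [signedArea_pt, div_eq_zero_iff] at h0
    rcases h0 with h0 | h0
    · exact det_ne_zero i j k hij hjk hik (by exact_mod_cast h0)
    · norm_num at h0
  weight_nonneg i := by split_ifs <;> norm_num
  weight_sum := by
    rw [Finset.sum_eq_add 0 1 (by decide) _ (by simp) (by simp)]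
    · norm_num
    · intro i _ hi
      rw [if_neg (not_or.2 hi)]

theorem pos_eq (v : Label) : surface.pos v = pt v := by
  rcases v with v | v <;> rfl

theorem hull_toFinset (l : List Label) :
    surface.hull (l.toFinset : Finset Label) = convexHull ℝ (pt '' {v | v ∈ l}) := by
  unfold InfSurface.hull
  congr 1
  ext x
  constructor
  · rintro ⟨v, hv, rfl⟩
    exact ⟨v, List.mem_toFinset.1 hv, (pos_eq v).symm⟩
  · rintro ⟨v, hv, rfl⟩
    exact ⟨v, List.mem_toFinset.2 hv, pos_eq v⟩

/-- The boundary crossing numbers of the parts add up to that of the triangle, as inner sides are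
run through once in each direction. -/
theorem sum_crossing_faces (x : Plane) :
    (faces.map fun l => ((cycleEdges (l.map pt)).map (crossing x)).sum).sum =
      (outerEdges.map fun e => crossing x (pt e.1, pt e.2)).sum := by
  have hmap (l : List Label) : (cycleEdges (l.map pt)).map (crossing x) =
      (cycleEdges l).map fun e => crossing x (pt e.1, pt e.2) := by
    unfold cycleEdges
    rw [← List.map_rotate, List.zip_map, List.map_map]
    rfl
  have hneg (l : List (Label × Label)) : (l.map fun e => -crossing x (pt e.1, pt e.2)).sum =
      -(l.map fun e => crossing x (pt e.1, pt e.2)).sum := by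
    induction l with
    | nil => rfl
    | cons e l ih => rw [List.map_cons, List.sum_cons, ih, List.map_cons, List.sum_cons, neg_add]
  have hinner : (innerEdges.map fun e => crossing x (pt e.1, pt e.2)).sum = 0 := by
    have h1 := (innerEdges_swap_perm.map fun e => crossing x (pt e.1, pt e.2)).sum_eq
    rw [List.map_map, show ((fun e : Label × Label => crossing x (pt e.1, pt e.2)) ∘ Prod.swap) =
      fun e => -crossing x (pt e.1, pt e.2) from funext fun e => crossing_swap x (pt e.1, pt e.2),
      hneg] at h1
    omega
  simp only [hmap]
  have h2 := (edges_perm.map fun e => crossing x (pt e.1, pt e.2)).sum_eq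
  rw [List.map_append, List.sum_append, hinner, add_zero] at h2
  rw [← h2, List.flatMap, List.map_flatten, List.sum_flatten, List.map_map, List.map_map]
  rfl

theorem polygon_eq : surface.polygon = convexHull ℝ {pt (.inl 0), pt (.inl 1), pt (.inl 2)} := by
  unfold InfSurface.polygon
  rw [← range_corner]

theorem interior_polygon_subset : interior surface.polygon ⊆
    ⋃ l ∈ faces, convexHull ℝ (pt '' {v | v ∈ l}) := by
  intro x hx
  rw [polygon_eq] at hx
  have hside (p q : Fin 3) (h : ∀ r : Fin 3, 0 ≤ det (.inl p) (.inl q) (.inl r))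
      (hpq : coord (.inl p) ≠ coord (.inl q)) : 0 < signedArea (pt (.inl p)) (pt (.inl q)) x := by
    refine signedArea_pos_of_mem_interior (fun heq => hpq (coord_eq_of_pt_eq heq))
      (convexHull_subset_signedArea_nonneg ?_) hx
    rintro y (rfl | rfl | rfl)
    exacts [signedArea_pt_nonneg (h 0), signedArea_pt_nonneg (h 1), signedArea_pt_nonneg (h 2)]
  have h1 := hside 0 1 (by decide +kernel) (by decide +kernel)
  have h2 := hside 1 2 (by decide +kernel) (by decide +kernel)
  have h3 := hside 2 0 (by decide +kernel) (by decide +kernel)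
  -- the triangle has crossing number `1` at `x`, so some part has a non-zero crossing number
  have hsum : (outerEdges.map fun e => crossing x (pt e.1, pt e.2)).sum = 1 := by
    have := sum_crossing_triangle (p := pt (.inl 0)) (q := pt (.inl 1)) (r := pt (.inl 2)) (x := x)
      ?_ ?_ ?_ h1 h2 h3 ?_ ?_
    · simp only [outerEdges, List.map_cons, List.map_nil, List.sum_cons, List.sum_nil]
      linarith
    all_goals simp [signedArea, coord, cornerCoord] at *
    all_goals linarith
  rw [← sum_crossing_faces x] at hsum
  by_contra hx'
  simp only [Set.mem_iUnion, not_exists] at hx'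
  rw [List.map_congr_left (g := fun _ => (0 : ℤ))] at hsum
  · simp at hsum
  · intro l hl
    refine sum_crossing_eq_zero (convex_convexHull ℝ _) (hx' l hl) ?_
    intro p hp
    obtain ⟨v, hv, rfl⟩ := List.mem_map.1 hp
    exact subset_convexHull ℝ _ ⟨v, hv, rfl⟩

theorem iUnion_faces : ⋃ l ∈ faces, convexHull ℝ (pt '' {v | v ∈ l}) = surface.polygon := by
  apply Set.Subset.antisymm
  · refine Set.iUnion₂_subset fun l hl => convexHull_min ?_ (convex_convexHull ℝ _)
    rintro _ ⟨v, hv, rfl⟩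
    rcases v with v | v
    · exact corner_mem v
    · exact interior_subset (inner_mem v)
  · have hne : (interior surface.polygon).Nonempty := ⟨_, inner_mem 0⟩
    have hclosed : IsClosed (⋃ l ∈ faces, convexHull ℝ (pt '' {v | v ∈ l})) := by
      refine (List.finite_toSet faces).isClosed_biUnion fun l _ => ?_
      exact ((List.finite_toSet l).image pt).isClosed_convexHull ℝ
    have hconv : Convex ℝ surface.polygon := convex_convexHull ℝ _
    have hcl := hconv.closure_interior_eq_closure_of_nonempty_interior hne
    calc surface.polygon ⊆ closure surface.polygon := subset_closure
      _ = closure (interior surface.polygon) := hcl.symm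
      _ ⊆ _ := closure_minimal interior_polygon_subset hclosed

/-- The partition of the triangle into the polygons `faces`. -/
noncomputable def partition : ConvexPartition surface where
  parts := (faces.map fun l => (l.toFinset : Finset Label)).toFinset
  three_le_card F hF := by
    obtain ⟨l, hl, rfl⟩ := List.mem_map.1 (List.mem_toFinset.1 hF)
    exact three_le_toFinset_card l hl
  convexIndependent F hF := by
    obtain ⟨l, hl, rfl⟩ := List.mem_map.1 (List.mem_toFinset.1 hF)
    simp only [pos_eq]
    refine convexIndependent_pt _ fun v => ?_
    obtain ⟨p, -, q, -, hneg, hpos⟩ := face_corner_pos l hl v (List.mem_toFinset.1 v.2)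
    exact ⟨p, q, hneg, fun k hk =>
      hpos k (List.mem_toFinset.1 k.2) fun h => hk (Subtype.ext h)⟩
  cover := by
    rw [← iUnion_faces]
    ext x
    simp only [Set.mem_iUnion, List.mem_toFinset, List.mem_map, exists_prop]
    constructor
    · rintro ⟨_, ⟨l, hl, rfl⟩, hx⟩
      rw [hull_toFinset] at hx
      exact ⟨l, hl, hx⟩
    · rintro ⟨l, hl, hx⟩
      refine ⟨_, ⟨l, hl, rfl⟩, ?_⟩
      rw [hull_toFinset]
      exact hx
  disjoint_interior F hF F' hF' hne := by
    obtain ⟨l, hl, rfl⟩ := List.mem_map.1 (List.mem_toFinset.1 hF)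
    obtain ⟨l', hl', rfl⟩ := List.mem_map.1 (List.mem_toFinset.1 hF')
    obtain ⟨e, -, hpq, hle, hge⟩ := exists_separating_side l hl l' hl' fun h => hne (by rw [h])
    rw [hull_toFinset, hull_toFinset]
    refine disjoint_interior_of_signedArea (p := pt e.1) (q := pt e.2)
      (fun h => hpq (coord_eq_of_pt_eq h)) (convexHull_subset_signedArea_nonneg ?_) ?_
    · rintro _ ⟨x, hx, rfl⟩
      exact signedArea_pt_nonneg (hge x hx)
    · intro x hx
      have := convexHull_subset_signedArea_nonneg (s := pt '' {v | v ∈ l'}) (p := pt e.2)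
        (q := pt e.1) ?_ x hx
      · rw [signedArea_swap] at this
        linarith
      · rintro _ ⟨x, hx, rfl⟩
        rw [signedArea_swap]
        have := signedArea_pt_nonpos (hle x hx)
        linarith
  mem_of_mem_hull F hF v hv := by
    obtain ⟨l, hl, rfl⟩ := List.mem_map.1 (List.mem_toFinset.1 hF)
    rw [hull_toFinset, pos_eq] at hv
    by_contra hmem
    obtain ⟨e, -, hneg, hpos⟩ :=
      exists_separating_side_vertex l hl v fun h => hmem (List.mem_toFinset.2 h)
    exact notMem_convexHull_of_det hneg hpos hv
  vertex_mem v := by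
    obtain ⟨l, hl, hv⟩ := mem_some_face v
    exact ⟨_, List.mem_toFinset.2 (List.mem_map.2 ⟨l, hl, rfl⟩), List.mem_toFinset.2 hv⟩

/-- The edges of the skeleton are sides of parts: diagonals run through the interior. -/
theorem isSide_of_adj {u v : Label} (h : partition.skeleton.Adj u v) : IsSide u v := by
  obtain ⟨hne, F, hF, hu, hv, hseg⟩ := h
  obtain ⟨l, hl, rfl⟩ := List.mem_map.1 (List.mem_toFinset.1 hF)
  rw [List.mem_toFinset] at hu hv
  refine ⟨hne, l, hl, hu, hv, ?_⟩
  by_contra hcon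
  push Not at hcon
  obtain ⟨⟨b, hb, hb'⟩, a, ha, ha'⟩ := hcon
  rw [hull_toFinset, pos_eq, pos_eq] at hseg
  have hmem {w : Label} (hw : w ∈ l) : pt w ∈ convexHull ℝ (pt '' {v | v ∈ l}) :=
    subset_convexHull ℝ _ ⟨w, hw, rfl⟩
  exact (hseg (midpoint_mem_segment (𝕜 := ℝ) _ _)).2 (midpoint_mem_interior (convex_convexHull ℝ _)
    (hmem hu) (hmem hv) (hmem ha) (hmem hb) (signedArea_pt_pos ha') (signedArea_pt_neg hb'))

/-! ### Monotone walks on the surface -/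

open ConvexPartition

/-- Twice the point 0. -/
def center₁ : ℤ × ℤ := (140858, 22260)

/-- Twice the point 1. -/
def center₂ : ℤ × ℤ := (141802, 22606)

/-- Twice the midpoint of the points 0 and 1. -/
def center₀ : ℤ × ℤ := (141330, 22433)

theorem isTwoPoint_surface : surface.IsTwoPoint 0 1 where
  ne := by decide
  fst := by simp
  snd := by simp
  other _ h h' := if_neg (not_or.2 ⟨h, h'⟩)

theorem isStep_of_inner_nonneg {z : ℤ × ℤ} {c : Plane} (h0 : c 0 = z.1 / 200000)
    (h1 : c 1 = z.2 / 200000) {u v : Label}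
    (h : 0 ≤ inner ℝ (surface.pos u - c) (surface.pos v - surface.pos u)) : IsStep z u v := by
  rw [pos_eq, pos_eq, PiLp.inner_apply, Fin.sum_univ_two] at h
  simp only [PiLp.sub_apply, pt_zero, pt_one, h0, h1, RCLike.inner_apply, conj_trivial] at h
  unfold IsStep
  have h' : (0 : ℝ) ≤ (2 * ((coord u).1 : ℝ) - z.1) * ((coord v).1 - (coord u).1) +
      (2 * ((coord u).2 : ℝ) - z.2) * ((coord v).2 - (coord u).2) := by
    linarith
  exact_mod_cast h'

theorem isStep_center₁ {u v : Label}
    (h : 0 ≤ inner ℝ (surface.pos u - surface.inner 0) (surface.pos v - surface.pos u)) :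
    IsStep center₁ u v := by
  refine isStep_of_inner_nonneg ?_ ?_ h <;>
  norm_num [center₁, coord, innerCoord]

theorem isStep_center₂ {u v : Label}
    (h : 0 ≤ inner ℝ (surface.pos u - surface.inner 1) (surface.pos v - surface.pos u)) :
    IsStep center₂ u v := by
  refine isStep_of_inner_nonneg ?_ ?_ h <;>
  norm_num [center₂, coord, innerCoord]

theorem isStep_center₀ {u v : Label}
    (h : 0 ≤ inner ℝ (surface.pos u - midpoint ℝ (surface.inner 0) (surface.inner 1))
      (surface.pos v - surface.pos u)) :
    IsStep center₀ u v := by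
  refine isStep_of_inner_nonneg ?_ ?_ h <;>
  norm_num [center₀, coord, innerCoord, midpoint_eq_smul_add]

variable {G : partition.skeleton.Subgraph}

/-- All steps of the walk are monotone with respect to `z / 2`. -/
def IsMonotone (z : ℤ × ℤ) {u v : Label} (p : G.spanningCoe.Walk u v) : Prop :=
  ∀ e ∈ p.darts, IsStep z e.fst e.snd

theorem IsMonotone.exists_mem_support {z : ℤ × ℤ} {u v : Label} {p : G.spanningCoe.Walk u v}
    (hp : IsMonotone z p) {Q X : List Label} (hQ : Confined z Q X) (hu : u ∈ Q) (hv : v ∉ Q) :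
    ∃ s ∈ p.support, s ∈ X :=
  p.exists_mem_support_of_exit (· ∈ Q) (· ∈ X) hu hv fun d hd hdQ =>
    hQ _ hdQ _ (isSide_of_adj (G.adj_sub d.adj)) (hp d hd)

theorem IsMonotone.mem_support {z : ℤ × ℤ} {u v s : Label} {p : G.spanningCoe.Walk u v}
    (hp : IsMonotone z p) {Q : List Label} (hQ : Confined z Q [s]) (hu : u ∈ Q) (hv : v ∉ Q) :
    s ∈ p.support := by
  obtain ⟨t, ht, hts⟩ := hp.exists_mem_support hQ hu hv
  rwa [List.mem_singleton.1 hts] at ht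

/-- A monotone walk stays in a set that monotone steps do not leave. -/
theorem IsMonotone.end_mem {z : ℤ × ℤ} {u v : Label} {p : G.spanningCoe.Walk u v}
    (hp : IsMonotone z p) {Q : List Label} (hQ : Confined z Q []) (hu : u ∈ Q) : v ∈ Q := by
  by_contra hv
  obtain ⟨t, -, ht⟩ := hp.exists_mem_support hQ hu hv
  exact absurd ht List.not_mem_nil

/-! ### Where monotone walks lead -/

/-- The chamber of the point 0. -/
def chamber₁ : List Label := [.inr 0, .inr 2, .inr 3, .inr 4, .inr 5]

/-- The chamber of the point 1. -/
def chamber₂ : List Label := [.inr 1, .inr 11, .inr 12, .inr 13, .inr 14, .inr 15]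

/-- The marked points of the spiral, in the order in which monotone walks visit them. -/
def spiral : List Label := [.inr 18, .inr 19, .inr 20, .inr 21, .inr 22]

theorem confined_chamber₁ : Confined center₁ chamber₁ [.inr 6] := by decide +kernel

theorem confined_chamber₂ : Confined center₂ chamber₂ [.inr 6] := by decide +kernel

/-- Walks from 0 to the exit of the chamber go through 5, and those from 1 through 14 and 15. -/
theorem confined_before₅ : Confined center₁ [.inr 0, .inr 2, .inr 3, .inr 4] [.inr 5] := by
  decide +kernel

theorem confined_before₁₄ : Confined center₂ [.inr 1, .inr 11, .inr 12, .inr 13] [.inr 14] := by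
  decide +kernel

theorem confined_before₁₅ : Confined center₂ [.inr 1, .inr 11, .inr 12, .inr 13, .inr 14]
    [.inr 15] := by
  decide +kernel

/-- From 6, walks that are monotone with respect to the midpoint are led back into the chambers. -/
theorem confined_midpoint : Confined center₀ [.inr 6, .inr 7] [.inr 5, .inr 15, .inr 14] := by
  decide +kernel

/-- A set of vertices that monotone walks from the point 0 do not leave: it is disjoint from the
chamber of the point 1. -/
def range₁ : List Label :=
  chamber₁ ++ [.inr 6, .inr 7, .inr 8, .inr 17] ++ spiral ++ [.inl 0, .inl 1, .inl 2]

/-- A set of vertices that monotone walks from the point 1 do not leave: it is disjoint from the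
chamber of the point 0. -/
def range₂ : List Label :=
  chamber₂ ++ [.inr 6, .inr 9, .inr 17] ++ spiral ++ [.inl 0, .inl 1, .inl 2]

theorem confined_range₁ : Confined center₁ range₁ [] := by decide +kernel

theorem confined_range₂ : Confined center₂ range₂ [] := by decide +kernel

/-- Monotone walks from 0 visit the points of the spiral one after the other. -/
theorem confined_spiral₁ : ∀ k < 5, Confined center₁
    (chamber₁ ++ [.inr 6, .inr 7, .inr 8] ++ spiral.take k) ((spiral.drop k).take 1) := by
  decide +kernel

/-- Monotone walks from 1 visit the points of the spiral one after the other. -/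
theorem confined_spiral₂ : ∀ k < 5, Confined center₂
    (chamber₂ ++ [.inr 6, .inr 9] ++ spiral.take k) ((spiral.drop k).take 1) := by
  decide +kernel

/-- The spiral separates the points 0, ..., 16 from 17 and the corners. -/
theorem spiral_separates : ∀ u v, IsSide u v → (∃ i < 17, u = .inr i) →
    (∃ i < 17, v = .inr i) ∨ v ∈ spiral := by
  decide +kernel

/-! ### Admissible cuts of the surface -/

/-- If the points of the spiral are forced one after the other, then a monotone walk to a corner
visits all of them. -/
theorem IsMonotone.mem_support_of_mem_spiral {z : ℤ × ℤ} {Q : List Label} {u : Label} {j : Fin 3}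
    (hQ : ∀ k < 5, Confined z (Q ++ spiral.take k) ((spiral.drop k).take 1))
    {p : G.spanningCoe.Walk u (.inl j)} (hp : IsMonotone z p) (hu : u ∈ Q)
    (hj : ∀ j : Fin 3, .inl j ∉ Q) {s : Label} (hs : s ∈ spiral) : s ∈ p.support := by
  obtain ⟨k, hk, rfl⟩ := List.getElem_of_mem hs
  have h := hQ k hk
  rw [show (spiral.drop k).take 1 = [spiral[k]] by
    rw [List.drop_eq_getElem_cons hk]; rfl] at h
  refine hp.mem_support h (List.mem_append_left _ hu) fun hmem => ?_
  rcases List.mem_append.1 hmem with hmem | hmem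
  · exact hj j hmem
  · have := List.mem_of_mem_take hmem
    simp [spiral] at this

theorem reachable_zero_one (hG : IsCut G) (h : IsAdmissible G) :
    G.spanningCoe.Reachable (.inr 0) (.inr 1) := by
  refine hG.reachable_of_separator h isTwoPoint_surface rfl (fun v => ∃ i < 17, v = .inr i)
    (· ∈ spiral) ⟨0, by decide, rfl⟩ ⟨1, by decide, rfl⟩ (fun j => by simp)
    (fun u v huv => spiral_separates u v (isSide_of_adj huv)) ?_ ?_
  · intro j p hp s hs
    exact IsMonotone.mem_support_of_mem_spiral confined_spiral₁
      (fun e he => isStep_center₁ (hp e he)) (by decide) (by decide) hs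
  · intro j p hp s hs
    exact IsMonotone.mem_support_of_mem_spiral confined_spiral₂
      (fun e he => isStep_center₂ (hp e he)) (by decide) (by decide) hs

theorem nonAdmissible : partition.NonAdmissible := by
  intro G hG h
  by_contra hB
  push Not at hB
  have hreach := reachable_zero_one hG h
  have h0 : (.inr 0 : Label) ∈ G.verts :=
    hG.weighted_mem 0 (by rw [isTwoPoint_surface.fst]; norm_num)
  obtain ⟨j, hj⟩ := hG.exists_reachable_corner h0
  have ho : IsOutlet G (.inr 0) j :=
    ⟨hj, fun j' hj' => eq_of_reachable_corners hB (hj'.symm.trans hj)⟩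
  have ho' : IsOutlet G (.inr 1) j :=
    ⟨hreach.symm.trans hj, fun j' hj' => ho.2 j' (hreach.trans hj')⟩
  obtain ⟨m, p, q, r, hpq, hpr, hqr, hp, hq, hr⟩ := hG.exists_meet h isTwoPoint_surface ho ho'
  replace hp : IsMonotone center₁ p := fun e he => isStep_center₁ (hp e he)
  replace hq : IsMonotone center₂ q := fun e he => isStep_center₂ (hq e he)
  replace hr : IsMonotone center₀ r := fun e he => isStep_center₀ (hr e he)
  have hm₁ : m ∈ range₁ := hp.end_mem confined_range₁ (by decide)
  have hm₂ : m ∈ range₂ := hq.end_mem confined_range₂ (by decide)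
  -- the walks merge outside of both chambers, hence after the common exit 6
  have h₁ : m ∉ chamber₁ := fun hm => (by decide : ∀ v ∈ chamber₁, v ∉ range₂) m hm hm₂
  have h₂ : m ∉ chamber₂ := fun hm => (by decide : ∀ v ∈ chamber₂, v ∉ range₁) m hm hm₁
  have hEp : .inr 6 ∈ p.support := hp.mem_support confined_chamber₁ (by decide) h₁
  have hEq : .inr 6 ∈ q.support := hq.mem_support confined_chamber₂ (by decide) h₂
  obtain rfl := hpq _ hEp hEq
  -- the common walk from 6 hits one of the walks that lead to 6
  obtain ⟨s, hsr, hs⟩ := hr.exists_mem_support confined_midpoint (by decide) (by simp)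
  simp only [List.mem_cons, List.not_mem_nil, or_false] at hs
  rcases hs with rfl | rfl | rfl
  · exact absurd (hpr _ (hp.mem_support confined_before₅ (by decide) (by decide)) hsr) (by decide)
  · exact absurd (hqr _ (hq.mem_support confined_before₁₅ (by decide) (by decide)) hsr) (by decide)
  · exact absurd (hqr _ (hq.mem_support confined_before₁₄ (by decide) (by decide)) hsr) (by decide)

theorem connectsWeighted (hG : IsCut G) (h : IsAdmissible G) : ConnectsWeighted G := by
  have key : ∀ i : Fin 23, 0 < surface.weight i → i = 0 ∨ i = 1 := by
    intro i hi
    by_contra hne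
    rw [not_or] at hne
    exact hi.ne' (isTwoPoint_surface.other i hne.1 hne.2)
  have hreach := reachable_zero_one hG h
  intro i j hi hj
  rcases key i hi with rfl | rfl <;> rcases key j hj with rfl | rfl
  exacts [.rfl, hreach, hreach.symm, .rfl]

end SpiralSurface

theorem theorem2 :
    ∃ (T : InfSurface) (L : ConvexPartition T),
      T.numCorners = 3 ∧
      (∃ c₁ c₂ : Fin T.numInner, c₁ ≠ c₂ ∧ T.weight c₁ = 1 / 2 ∧ T.weight c₂ = 1 / 2 ∧
        ∀ i, i ≠ c₁ → i ≠ c₂ → T.weight i = 0) ∧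
      L.NonAdmissible ∧
      ∀ G : L.skeleton.Subgraph, ConvexPartition.IsCut G → ConvexPartition.IsAdmissible G →
        ConvexPartition.ConnectsWeighted G := by
  have h := SpiralSurface.isTwoPoint_surface
  exact ⟨SpiralSurface.surface, SpiralSurface.partition, rfl, ⟨0, 1, h.ne, h.fst, h.snd, h.other⟩,
    SpiralSurface.nonAdmissible, fun G => SpiralSurface.connectsWeighted⟩
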